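/- Polynomials $P$ on $\mathbb{R}^d$ have complex coefficients; $P(\partial)$ is the corresponding constant coefficient differential operator, so that $P(\partial)e^{i\lambda\cdot x}=P(i\lambda)e^{i\lambda\cdot x}$. The Fourier transform is normalized by $\mathcal F\varphi(\lambda)=(2\pi)^{-d/2}\int_{\mathbb{R}^d}\varphi(x)e^{-i\lambda\cdot x}\,dx$ for Schwartz functions $\varphi$, and $\langle\mathcal F T,\varphi\rangle=\langle T,\mathcal F\varphi\rangle$ for tempered distributions $T$. For a tempered distribution $T$ put $R(P,T)=\sup\{|P(i\lambda)|:\lambda\in\operatorname{supp}T\}\in[0,\infty]$, with $R(P,0)=0$. Let $f\in C^\infty(\mathbb{R}^d)$ be a tempered distribution (i.e. the distribution $\varphi\mapsto\int f\varphi$ on $C_c^\infty(\mathbb{R}^d)$ extends continuously to the Schwartz space) such that $\operatorname{supp}\mathcal F f$ is compact. For a polynomial $P$ let $\widetilde R(P,f)$ be the infimum of all $R\ge 0$ for which there exist $N\in\{0,1,2,\dots\}$ and $C\ge 0$ such that $$|P(\partial)^nf(x)|\le C\,n^N R^n(1+|x|)^N\qquad\text{for all } n\in\{1,2,\dots\},\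 x\in\mathbb{R}^d .$$ Say that a set $\mathcal P$ of polynomials determines a compact set $K\subset\mathbb{R}^d$ if $K=\bigcap_{P\in\mathcal P}\{\lambda\in\mathbb{R}^d:|P(i\lambda)|\le\max_{\mu\in K}|P(i\mu)|\}$, where the maximum is read as $0$ if $K=\emptyset$. Then: 1. For every polynomial $P$, $\widetilde R(P,f)$ is finite and $\widetilde R(P,f)=R(P,\mathcal F f)$. 2. Let $K\subset\mathbb{R}^d$ be non-empty and compact, and let $\mathcal P_K$ be any set of polynomials determining $K$. Then $\operatorname{supp}\mathcal F f\subset K$ if and only if $\widetilde R(P,f)\le\max_{\lambda\in K}|P(i\lambda)|$ for all $P\in\mathcal P_K$. 3. Let $\mathcal P$ be any set of polynomials determining $\operatorname{supp}\mathcal F f$. Then $\lambda\in\mathbb{R}^d$ lies in $\operatorname{supp}\mathcal F f$ if and only if $|P(i\lambda)|\le\widetilde R(P,f)$ for all $P\in\mathcal P$. 4. $\operatorname{supp}\mathcal F f=\{\lambda\in\mathbb{R}^d:|P(i\lambda)|\le\widetilde R(P,f)\text{ for all polynomials }P\}$. -/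

import Mathlib

open scoped SchwartzMap ContDiff FourierTransform ENNReal NNReal

noncomputable section

namespace RealPaleyWiener

/-- The Euclidean space `ℝ^d`. -/
abbrev Rd (d : ℕ) : Type := EuclideanSpace ℝ (Fin d)

/-- The value `P(iξ)` of a complex polynomial `P` in `d` variables at `iξ`, for `ξ ∈ ℝ^d`. -/
def evalI {d : ℕ} (P : MvPolynomial (Fin d) ℂ) (ξ : Rd d) : ℂ :=
  MvPolynomial.eval (fun j => Complex.I * ((ξ j : ℝ) : ℂ)) P

/-! ### Constant coefficient differential operators -/

/-- The partial derivative `∂_j f`. -/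
def partialDeriv {d : ℕ} (j : Fin d) (f : Rd d → ℂ) : Rd d → ℂ :=
  fun x => fderiv ℝ f x (EuclideanSpace.single j (1 : ℝ))

/-- `∂^m f = ∂_0^{m 0} ⋯ ∂_{d-1}^{m (d-1)} f` for a multi-index `m`. -/
def multiDeriv {d : ℕ} (m : Fin d →₀ ℕ) (f : Rd d → ℂ) : Rd d → ℂ :=
  (List.finRange d).foldr (fun j g => (partialDeriv j)^[m j] g) f

/-- `P(∂) f = ∑_m c_m ∂^m f` for a polynomial `P = ∑_m c_m X^m`. -/
def diffOp {d : ℕ} (P : MvPolynomial (Fin d) ℂ) (f : Rd d → ℂ) : Rd d → ℂ :=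
  fun x => ∑ m ∈ P.support, P.coeff m * multiDeriv m f x

/-! ### The Fourier transform, unitary normalization -/

/-- The dilation `ξ ↦ ξ / (2π)`. -/
def dilation (d : ℕ) : Rd d ≃L[ℝ] Rd d :=
  ContinuousLinearEquiv.smulLeft (Units.mk0 ((2 * Real.pi)⁻¹ : ℝ) (by positivity))

/-- The Fourier transform on Schwartz functions, normalized as
`(ℱ φ)(ξ) = (2π)^{-d/2} ∫ φ(x) e^{-i ξ·x} dx`; see `fourierS_apply`. -/
def fourierS (d : ℕ) : 𝓢(Rd d, ℂ) →L[ℂ] 𝓢(Rd d, ℂ) :=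
  (((2 * Real.pi) ^ (-(d : ℝ) / 2) : ℝ) : ℂ) •
    (SchwartzMap.compCLMOfContinuousLinearEquiv ℂ (dilation d)).comp
      (FourierTransform.fourierCLM ℂ 𝓢(Rd d, ℂ))

theorem fourierS_apply {d : ℕ} (φ : 𝓢(Rd d, ℂ)) (ξ : Rd d) :
    fourierS d φ ξ = (((2 * Real.pi) ^ (-(d : ℝ) / 2) : ℝ) : ℂ) *
      ∫ x : Rd d, φ x * Complex.exp (-Complex.I * ((∑ j, ξ j * x j : ℝ) : ℂ)) := by
  have hpi : (Real.pi : ℂ) ≠ 0 := by exact_mod_cast Real.pi_ne_zero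
  have h1 : fourierS d φ ξ = (((2 * Real.pi) ^ (-(d : ℝ) / 2) : ℝ) : ℂ) *
      (𝓕 φ) (dilation d ξ) := rfl
  have h2 : dilation d ξ = (2 * Real.pi)⁻¹ • ξ := rfl
  rw [h1, h2, SchwartzMap.fourier_coe, Real.fourier_eq']
  congr 2
  ext x
  rw [smul_eq_mul, mul_comm, inner_smul_right, PiLp.inner_apply]
  congr 2
  push_cast
  simp only [RCLike.inner_apply, conj_trivial]
  push_cast
  field_simp

/-- The Fourier transform of a tempered distribution: `⟨ℱ T, φ⟩ = ⟨T, ℱ φ⟩`. -/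
def fourierT {d : ℕ} (T : 𝓢'(Rd d, ℂ)) : 𝓢'(Rd d, ℂ) :=
  PointwiseConvergenceCLM.precomp ℂ (fourierS d) T

theorem fourierT_apply {d : ℕ} (T : 𝓢'(Rd d, ℂ)) (φ : 𝓢(Rd d, ℂ)) :
    fourierT T φ = T (fourierS d φ) := rfl

/-- The tempered distribution `T` is (the extension to Schwartz functions of) the distribution
`φ ↦ ∫ f φ` on compactly supported smooth functions. Since these are dense in the Schwartz space,
`T` is determined by `f`. -/
def Represents {d : ℕ} (f : Rd d → ℂ) (T : 𝓢'(Rd d, ℂ)) : Prop :=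
  ∀ φ : 𝓢(Rd d, ℂ), HasCompactSupport (φ : Rd d → ℂ) → T φ = ∫ x : Rd d, f x * φ x

/-! ### The quantities `R(P, T)` and `R̃(P, f)` -/

/-- `sup_{ξ ∈ S} |P(iξ)|` in `[0, ∞]`; it is a maximum if `S` is compact and non-empty, and `0` if
`S` is empty. -/
def supOn {d : ℕ} (P : MvPolynomial (Fin d) ℂ) (S : Set (Rd d)) : ℝ≥0∞ :=
  ⨆ ξ ∈ S, ‖evalI P ξ‖ₑ

/-- `R(P, T) = sup {|P(iξ)| : ξ ∈ supp T}` in `[0, ∞]`, which is `0` if `T = 0`. -/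
def supportRadius {d : ℕ} (P : MvPolynomial (Fin d) ℂ) (T : 𝓢'(Rd d, ℂ)) : ℝ≥0∞ :=
  supOn P (Distribution.dsupport T)

/-- There are `N ∈ ℕ₀` and `C ≥ 0` with `|P(∂)^n f(x)| ≤ C n^N R^n (1 + |x|)^N` for all integers
`n ≥ 1` and all `x`. -/
def GrowthBound {d : ℕ} (P : MvPolynomial (Fin d) ℂ) (f : Rd d → ℂ) (R : ℝ≥0) : Prop :=
  ∃ (N : ℕ) (C : ℝ), 0 ≤ C ∧ ∀ n : ℕ, 1 ≤ n → ∀ x : Rd d,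
    ‖(diffOp P)^[n] f x‖ ≤ C * (n : ℝ) ^ N * (R : ℝ) ^ n * (1 + ‖x‖) ^ N

/-- `R̃(P, f)`: the infimum in `[0, ∞]` of all `R ≥ 0` with `GrowthBound P f R`; it is `∞` if there
is no such `R`. -/
def growthExponent {d : ℕ} (P : MvPolynomial (Fin d) ℂ) (f : Rd d → ℂ) : ℝ≥0∞ :=
  ⨅ (R : ℝ≥0) (_ : GrowthBound P f R), (R : ℝ≥0∞)

/-- The set `𝒬` of polynomials determines `K`:
`K = ⋂_{P ∈ 𝒬} {ξ : |P(iξ)| ≤ sup_{η ∈ K} |P(iη)|}`. -/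
def Determines {d : ℕ} (𝒬 : Set (MvPolynomial (Fin d) ℂ)) (K : Set (Rd d)) : Prop :=
  K = ⋂ P ∈ 𝒬, {ξ : Rd d | ‖evalI P ξ‖ₑ ≤ supOn P K}

end RealPaleyWiener

end

/-! The Fourier transform turns `P(∂)` into multiplication by `p(ξ) = P(iξ)`, so the pairing of
`P(∂)^n f` with `φ` is the value of `U = fourierT T` at `p^n ℱ⁻¹φ` (`HasSymbol.iterate_diffOp`).
Both inequalities of part 1 come from this identity.

Upper bound (`growthBound_of_supportRadius_lt`): `U` sees its test function only near `supp U`, so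
`p` may be cut off to a Schwartz function bounded by some `R' < R`. `U` is bounded by finitely many
Schwartz seminorms, and derivatives of `p^n` up to a fixed order are `O(R^n)`. Letting `φ`
approximate the point mass at `x` costs only a power of `1 + |x|`, because `φ` is supported in the
ball of radius `1 + |x|` and has `L¹` norm one.

Lower bound (`supportRadius_le_of_growthBound`): if `|p| > R₁ > R` on the support of a test function
`u`, then `u = p^n (p^{-n} u)`, so `U u` is the pairing of `P(∂)^n f` with `ℱ(p^{-n} u)`. The growth
bound makes this `O(n^N (R/R₁)^n)`, which tends to zero. Hence `U` vanishes wherever `|p| > R`.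

Parts 2 and 3 follow formally from part 1 and the definition of a determining set. Part 4 also needs
one polynomial separating a given point from a compact set (`exists_supOn_lt_enorm_evalI`). -/

noncomputable section

namespace RealPaleyWiener

open Filter Topology Set LineDeriv MeasureTheory

/-! ### Cutoffs, density of compactly supported functions, and supports of tempered distributions -/

section General

variable {E : Type*} [NormedAddCommGroup E] [NormedSpace ℝ E]

/-- Smooth Urysohn lemma for a compact set inside an open set. -/
theorem exists_smooth_cutoff [FiniteDimensional ℝ E] {K V : Set E} (hK : IsCompact K)
    (hV : IsOpen V) (hKV : K ⊆ V) :
    ∃ g : E → ℝ, ContDiff ℝ ∞ g ∧ HasCompactSupport g ∧ tsupport g ⊆ V ∧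
      (∀ᶠ x in 𝓝ˢ K, g x = 1) ∧ ∀ x, g x ∈ Icc (0 : ℝ) 1 := by
  obtain ⟨L, hL, hKL, hLV⟩ := exists_compact_between hK hV hKV
  obtain ⟨g, hg1, hg0, hg⟩ := exists_contMDiffMap_one_nhds_of_subset_interior
    (n := (⊤ : ℕ∞)) (modelWithCornersSelf ℝ E) hK.isClosed hKL
  have hsub : tsupport g ⊆ L :=
    closure_minimal (fun x hx => by_contra fun h => hx (hg0 x h)) hL.isClosed
  exact ⟨g, g.contMDiff.contDiff, hL.of_isClosed_subset isClosed_closure hsub,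
    hsub.trans hLV, hg1, hg⟩

theorem norm_iteratedFDeriv_one_sub_le {χ : E → ℂ} (hχ : HasCompactSupport χ)
    (hs : ContDiff ℝ ∞ χ) (n : ℕ) :
    ∃ B, 0 ≤ B ∧ ∀ i ≤ n, ∀ x, ‖iteratedFDeriv ℝ i (fun y => 1 - χ y) x‖ ≤ B := by
  let ψ := hχ.toSchwartzMap hs
  have hψ : (ψ : E → ℂ) = χ := rfl
  refine ⟨1 + ∑ i ∈ Finset.range (n + 1), SchwartzMap.seminorm ℝ 0 i ψ, by positivity, ?_⟩
  intro i hi x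
  have h1 : iteratedFDeriv ℝ i (fun y => 1 - χ y) x =
      iteratedFDeriv ℝ i (fun _ : E => (1 : ℂ)) x - iteratedFDeriv ℝ i χ x :=
    iteratedFDeriv_sub_apply contDiffAt_const (hs.of_le (by exact_mod_cast le_top)).contDiffAt
  have h2 : ‖iteratedFDeriv ℝ i (fun _ : E => (1 : ℂ)) x‖ ≤ 1 := by
    rcases Nat.eq_zero_or_pos i with rfl | h
    · simp
    · rw [iteratedFDeriv_const_of_ne h.ne']; simp
  have h3 : ‖iteratedFDeriv ℝ i χ x‖ ≤ SchwartzMap.seminorm ℝ 0 i ψ :=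
    ψ.norm_iteratedFDeriv_le_seminorm ℝ i x
  have h4 : SchwartzMap.seminorm ℝ 0 i ψ ≤
      ∑ i ∈ Finset.range (n + 1), SchwartzMap.seminorm ℝ 0 i ψ :=
    Finset.single_le_sum (f := fun i => SchwartzMap.seminorm ℝ 0 i ψ)
      (fun _ _ => apply_nonneg _ _) (Finset.mem_range.2 (by omega))
  rw [h1]
  exact (norm_sub_le _ _).trans (by linarith)

theorem contDiff_coe_of_infty {χ : E → ℂ} (hs : ContDiff ℝ ∞ χ) (n : ℕ) : ContDiff ℝ n χ :=
  hs.of_le (by exact_mod_cast le_top)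

/-- Compactly supported functions are dense in the Schwartz space, by cutting off. -/
theorem exists_seq_hasCompactSupport_tendsto [FiniteDimensional ℝ E] (φ : 𝓢(E, ℂ)) :
    ∃ u : ℕ → 𝓢(E, ℂ), (∀ k, HasCompactSupport (u k)) ∧ (∀ k, tsupport (u k) ⊆ tsupport φ) ∧
      Tendsto u atTop (𝓝 φ) := by
  obtain ⟨g, hg, hgc, -, hg1, -⟩ := exists_smooth_cutoff (isCompact_closedBall (0 : E) 1)
    isOpen_univ (subset_univ _)
  let χ : E → ℂ := fun x => (g x : ℂ)
  have hχ : ContDiff ℝ ∞ χ := Complex.ofRealCLM.contDiff.comp hg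
  have hχc : HasCompactSupport χ := hgc.comp_left (g := fun r : ℝ => (r : ℂ)) (by simp)
  have hχ1 : ∀ x : E, ‖x‖ ≤ 1 → χ x = 1 := fun x hx => by
    have := hg1.self_of_nhdsSet x (by simpa using hx)
    simp [χ, this]
  let χk : ℕ → E → ℂ := fun k x => χ (((k : ℝ) + 1)⁻¹ • x)
  have hk0 : ∀ k : ℕ, (0 : ℝ) < ((k : ℝ) + 1)⁻¹ := fun k => by positivity
  have hχk : ∀ k, ContDiff ℝ ∞ (χk k) := fun k => hχ.comp (contDiff_const_smul _)
  have hχkc : ∀ k, HasCompactSupport (χk k) := fun k => hχc.comp_smul (hk0 k).ne'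
  have htg : ∀ k, (χk k).HasTemperateGrowth := fun k => (hχkc k).hasTemperateGrowth (hχk k)
  let u : ℕ → 𝓢(E, ℂ) := fun k => SchwartzMap.smulLeftCLM ℂ (χk k) φ
  have hu : ∀ k x, u k x = χk k x * φ x := fun k x => by
    simp [u, SchwartzMap.smulLeftCLM_apply_apply (htg k)]
  have hu' : ∀ k, (u k : E → ℂ) = fun x => χk k x * φ x := fun k => funext (hu k)
  refine ⟨u, fun k => ?_, fun k => ?_, ?_⟩
  · rw [hu' k]; exact (hχkc k).mul_right
  · rw [hu' k]; exact tsupport_mul_subset_right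
  rw [(schwartz_withSeminorms ℝ E ℂ).tendsto_nhds_atTop u φ]
  rintro ⟨m, n⟩ ε hε
  obtain ⟨B, hB0, hB⟩ := norm_iteratedFDeriv_one_sub_le hχc hχ n
  let M : ℝ := ∑ i ∈ Finset.range (n + 1),
    (n.choose i : ℝ) * B * SchwartzMap.seminorm ℝ (m + 1) (n - i) φ
  have hM0 : 0 ≤ M := by positivity
  -- The factor `1 - χk k` vanishes on `‖x‖ < k + 1`. Outside that ball, one extra power of `‖x‖` is
  -- worth a factor `(k + 1)⁻¹`, while the dilation does not increase the derivative bounds of the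
  -- cutoff.
  have key : ∀ k : ℕ, SchwartzMap.seminorm ℝ m n (u k - φ) ≤ ((k : ℝ) + 1)⁻¹ * M := by
    intro k
    refine SchwartzMap.seminorm_le_bound ℝ m n _ (by positivity) fun x => ?_
    have hfun : ((u k - φ : 𝓢(E, ℂ)) : E → ℂ) = -fun x => (1 - χk k x) * φ x := by
      ext x; simp [hu]; ring
    rw [hfun, iteratedFDeriv_neg, Pi.neg_apply, norm_neg]
    by_cases hx : ‖x‖ < k + 1
    · have hev : (fun x => (1 - χk k x) * φ x) =ᶠ[𝓝 x] fun _ => (0 : ℂ) := by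
        filter_upwards [(isOpen_lt continuous_norm continuous_const).mem_nhds hx] with y hy
        have : χk k y = 1 := hχ1 _ (by
          rw [norm_smul, Real.norm_of_nonneg (hk0 k).le, inv_mul_le_iff₀ (by positivity), mul_one]
          exact le_of_lt hy)
        simp [this]
      rw [hev.iteratedFDeriv ℝ n |>.self_of_nhds]
      simp only [iteratedFDeriv_fun_zero, Pi.zero_apply, norm_zero, mul_zero]
      positivity
    · push Not at hx
      have hs1 : ContDiff ℝ n (fun x => 1 - χk k x) :=
        contDiff_const.sub (contDiff_coe_of_infty (hχk k) n)
      have hD : ∀ i ≤ n, ‖iteratedFDeriv ℝ i (fun x => 1 - χk k x) x‖ ≤ B := by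
        intro i hi
        have hc : iteratedFDeriv ℝ i (fun x => 1 - χk k x) =
            fun x => ((k : ℝ) + 1)⁻¹ ^ i •
              iteratedFDeriv ℝ i (fun y => 1 - χ y) (((k : ℝ) + 1)⁻¹ • x) :=
          iteratedFDeriv_comp_const_smul (f := fun y => 1 - χ y) _
            (contDiff_const.sub (contDiff_coe_of_infty hχ i))
        rw [hc, norm_smul, norm_pow, Real.norm_of_nonneg (hk0 k).le]
        have h1 : ((k : ℝ) + 1)⁻¹ ^ i ≤ 1 :=
          pow_le_one₀ (hk0 k).le (inv_le_one_of_one_le₀ (by linarith [k.cast_nonneg (α := ℝ)]))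
        calc _ ≤ 1 * B := mul_le_mul h1 (hB i hi _) (norm_nonneg _) zero_le_one
          _ = B := one_mul B
      have hxk : ‖x‖ ^ m ≤ ((k : ℝ) + 1)⁻¹ * ‖x‖ ^ (m + 1) := by
        rw [pow_succ, le_inv_mul_iff₀ (by positivity), mul_comm]
        exact mul_le_mul_of_nonneg_left hx (by positivity)
      calc ‖x‖ ^ m * ‖iteratedFDeriv ℝ n (fun x => (1 - χk k x) * φ x) x‖
          ≤ (((k : ℝ) + 1)⁻¹ * ‖x‖ ^ (m + 1)) * ∑ i ∈ Finset.range (n + 1), (n.choose i : ℝ) *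
            ‖iteratedFDeriv ℝ i (fun x => 1 - χk k x) x‖ * ‖iteratedFDeriv ℝ (n - i) φ x‖ :=
            mul_le_mul hxk (norm_iteratedFDeriv_mul_le hs1 (φ.smooth n) x le_rfl)
              (norm_nonneg _) (by positivity)
        _ ≤ ((k : ℝ) + 1)⁻¹ * M := by
            rw [mul_assoc, Finset.mul_sum]
            refine mul_le_mul_of_nonneg_left (Finset.sum_le_sum fun i hi => ?_) (hk0 k).le
            have h1 := hD i (by have := Finset.mem_range.1 hi; omega)
            have h2 := φ.le_seminorm ℝ (m + 1) (n - i) x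
            calc _ = (n.choose i : ℝ) * ‖iteratedFDeriv ℝ i (fun x => 1 - χk k x) x‖ *
                  (‖x‖ ^ (m + 1) * ‖iteratedFDeriv ℝ (n - i) φ x‖) := by ring
              _ ≤ _ := by gcongr
  have hlim : Tendsto (fun k : ℕ => ((k : ℝ) + 1)⁻¹ * M) atTop (𝓝 0) := by
    have := (tendsto_one_div_add_atTop_nhds_zero_nat (𝕜 := ℝ)).mul_const M
    simpa using this
  obtain ⟨k₀, hk₀⟩ := eventually_atTop.1 (hlim.eventually (gt_mem_nhds hε))
  exact ⟨k₀, fun k hk => (key k).trans_lt (hk₀ k hk)⟩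

/-- A smooth cutoff, as a complex Schwartz function. -/
theorem exists_schwartz_cutoff [FiniteDimensional ℝ E] {K V : Set E} (hK : IsCompact K)
    (hV : IsOpen V) (hKV : K ⊆ V) :
    ∃ g : 𝓢(E, ℂ), HasCompactSupport g ∧ tsupport g ⊆ V ∧
      (∀ᶠ x in 𝓝ˢ K, g x = 1) ∧ ∀ x, ‖g x‖ ≤ 1 := by
  obtain ⟨g, hg, hgc, hgV, hg1, hg01⟩ := exists_smooth_cutoff hK hV hKV
  have hc : HasCompactSupport fun x => (g x : ℂ) :=
    hgc.comp_left (g := fun r : ℝ => (r : ℂ)) (by simp)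
  have hs : ContDiff ℝ ∞ fun x => (g x : ℂ) := Complex.ofRealCLM.contDiff.comp hg
  refine ⟨hc.toSchwartzMap hs, hc,
    (tsupport_comp_subset (g := fun r : ℝ => (r : ℂ)) (by simp) g).trans hgV, ?_, fun x => ?_⟩
  · filter_upwards [hg1] with x hx
    rw [HasCompactSupport.toSchwartzMap_toFun, hx, Complex.ofReal_one]
  · rw [HasCompactSupport.toSchwartzMap_toFun, Complex.norm_real, Real.norm_of_nonneg (hg01 x).1]
    exact (hg01 x).2

/-- A distribution vanishing near each point of a compact set vanishes on the test functions
supported in it. -/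
theorem apply_eq_zero_of_hasCompactSupport [FiniteDimensional ℝ E] (U : 𝓢'(E, ℂ)) (u : 𝓢(E, ℂ))
    (hu : HasCompactSupport u) (hd : Disjoint (tsupport u) (Distribution.dsupport U)) :
    U u = 0 := by
  -- The property "has an open neighbourhood on which `U` vanishes" is local and passes to finite
  -- unions, so compactness reduces it to single points.
  have H : ∃ V : Set E, IsOpen V ∧ tsupport u ⊆ V ∧
      ∀ v : 𝓢(E, ℂ), HasCompactSupport v → tsupport v ⊆ V → U v = 0 := by
    refine IsCompact.induction_on (p := fun A => ∃ V : Set E, IsOpen V ∧ A ⊆ V ∧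
      ∀ v : 𝓢(E, ℂ), HasCompactSupport v → tsupport v ⊆ V → U v = 0) hu ?_ ?_ ?_ ?_
    · refine ⟨∅, isOpen_empty, subset_rfl, fun v _ hv => ?_⟩
      have : v = 0 := by
        ext x
        exact image_eq_zero_of_notMem_tsupport fun h => hv h
      simp [this]
    · rintro s t hst ⟨V, hV, htV, h⟩
      exact ⟨V, hV, hst.trans htV, h⟩
    · rintro s t ⟨V, hV, hsV, h⟩ ⟨W, hW, htW, h'⟩
      refine ⟨V ∪ W, hV.union hW, union_subset_union hsV htW, fun v hv hvVW => ?_⟩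
      -- A two-piece partition of unity: `g v` is supported in `V`, and `(1 - g) v` in `W` because
      -- `g = 1` near the part of `tsupport v` outside `W`.
      obtain ⟨g, hgc, hgV, hg1, -⟩ := exists_schwartz_cutoff (hv.diff hW) hV
        (fun x hx => (hvVW hx.1).resolve_right hx.2)
      have hg1' : ∀ x ∈ tsupport v \ W, ∀ᶠ y in 𝓝 x, g y = 1 := fun x hx =>
        hg1.filter_mono (nhds_le_nhdsSet hx)
      let v₁ := SchwartzMap.smulLeftCLM ℂ (g : E → ℂ) v
      have hv₁ : (v₁ : E → ℂ) = fun x => g x * v x := by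
        ext x; simp [v₁, SchwartzMap.smulLeftCLM_apply_apply g.hasTemperateGrowth]
      have e1 : U v₁ = 0 := by
        refine h v₁ ?_ ?_
        · rw [hv₁]; exact hgc.mul_right
        · rw [hv₁]; exact tsupport_mul_subset_left.trans hgV
      have hsub : tsupport ((v - v₁ : 𝓢(E, ℂ)) : E → ℂ) ⊆ tsupport v := by
        have : ((v - v₁ : 𝓢(E, ℂ)) : E → ℂ) = fun x => (1 - g x) * v x := by
          ext x; simp [hv₁]; ring
        rw [this]; exact tsupport_mul_subset_right
      have e2 : U (v - v₁) = 0 := by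
        refine h' _ (hv.of_isClosed_subset isClosed_closure hsub) fun x hx => ?_
        by_contra hxW
        have := hg1' x ⟨hsub hx, hxW⟩
        refine (notMem_tsupport_iff_eventuallyEq.2 ?_) hx
        filter_upwards [this] with y hy
        simp [hv₁, hy]
      have : v = v₁ + (v - v₁) := by abel
      rw [this, map_add, e1, e2, add_zero]
    · intro x hx
      have hx' := Set.disjoint_left.1 hd hx
      rw [Distribution.notMem_dsupport_iff] at hx'
      obtain ⟨s, hs, hso, hxs⟩ := hx'
      exact ⟨s, mem_nhdsWithin_of_mem_nhds (hso.mem_nhds hxs), s, hso, subset_rfl,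
        fun v _ hv => hs v hv⟩
  obtain ⟨V, -, hV, h⟩ := H
  exact h u hu hV

/-- Cutting off does not enlarge the support, so continuity of `U` and density remove the
compactness assumption. -/
theorem apply_eq_zero_of_disjoint_dsupport [FiniteDimensional ℝ E] (U : 𝓢'(E, ℂ)) (u : 𝓢(E, ℂ))
    (hd : Disjoint (tsupport u) (Distribution.dsupport U)) : U u = 0 := by
  obtain ⟨v, hvc, hvs, hv⟩ := exists_seq_hasCompactSupport_tendsto u
  have h1 : Tendsto (fun k => U (v k)) atTop (𝓝 (U u)) := (U.continuous.tendsto u).comp hv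
  have h2 : ∀ k, U (v k) = 0 := fun k =>
    apply_eq_zero_of_hasCompactSupport U (v k) (hvc k) (hd.mono_left (hvs k))
  simp only [h2] at h1
  exact tendsto_nhds_unique h1 tendsto_const_nhds

/-- Two test functions that agree near the support of a distribution have the same value. -/
theorem apply_eq_of_eventuallyEq_nhdsSet_dsupport [FiniteDimensional ℝ E] (U : 𝓢'(E, ℂ))
    (u v : 𝓢(E, ℂ)) (h : ∀ᶠ x in 𝓝ˢ (Distribution.dsupport U), u x = v x) : U u = U v := by
  rw [← sub_eq_zero, ← map_sub]
  refine apply_eq_zero_of_disjoint_dsupport U _ (Set.disjoint_right.2 fun x hx => ?_)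
  rw [notMem_tsupport_iff_eventuallyEq]
  filter_upwards [h.filter_mono (nhds_le_nhdsSet hx)] with y hy
  simp [hy]

end General

/-! ### Growth in `n` of Schwartz seminorms of `χ pⁿ φ` -/

section Powers

variable {E : Type*} [NormedAddCommGroup E] [NormedSpace ℝ E]

theorem sum_choose_mul_le {n : ℕ} {a b : ℕ → ℝ} {A B : ℝ} (hA : 0 ≤ A)
    (ha : ∀ i ≤ n, a i ≤ A) (hb : ∀ i ≤ n, b i ≤ B) (hb0 : ∀ i, 0 ≤ b i) :
    ∑ i ∈ Finset.range (n + 1), (n.choose i : ℝ) * a i * b (n - i) ≤ 2 ^ n * A * B := by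
  have h : ∀ i ∈ Finset.range (n + 1), (n.choose i : ℝ) * a i * b (n - i) ≤
      (n.choose i : ℝ) * (A * B) := fun i hi => by
    rw [mul_assoc]
    have hi := Finset.mem_range.1 hi
    exact mul_le_mul_of_nonneg_left (mul_le_mul (ha i (by omega)) (hb _ (by omega)) (hb0 _) hA)
      (Nat.cast_nonneg _)
  refine (Finset.sum_le_sum h).trans (le_of_eq ?_)
  rw [← Finset.sum_mul, ← Nat.cast_sum, Nat.sum_range_choose]
  push_cast; ring

/-- The derivatives of order at most `l` of the powers of `p` grow like `R ^ n` for each `R`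
larger than `sup |p|`. -/
theorem exists_norm_iteratedFDeriv_pow_le (p : 𝓢(E, ℂ)) {R' R : ℝ} (hp : ∀ x, ‖p x‖ ≤ R')
    (hR : R' < R) (l : ℕ) :
    ∃ A, 1 ≤ A ∧ ∀ n : ℕ, ∀ j ≤ l, ∀ x,
      ‖iteratedFDeriv ℝ j (fun y => p y ^ n) x‖ ≤ A ^ j * R ^ n := by
  have hR'0 : 0 ≤ R' := (norm_nonneg _).trans (hp 0)
  have hR0 : 0 < R := hR'0.trans_lt hR
  let M : ℝ := ∑ i ∈ Finset.range (l + 1), SchwartzMap.seminorm ℝ 0 i p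
  have hM0 : 0 ≤ M := by positivity
  have hM : ∀ i ≤ l, ∀ x, ‖iteratedFDeriv ℝ i p x‖ ≤ M := fun i hi x =>
    (p.norm_iteratedFDeriv_le_seminorm ℝ i x).trans
      (Finset.single_le_sum (f := fun i => SchwartzMap.seminorm ℝ 0 i p)
        (fun _ _ => apply_nonneg _ _) (Finset.mem_range.2 (by omega)))
  -- Chosen so that `2 ^ l * M ≤ (R - R') * A`, which closes the induction on `n`.
  let A : ℝ := 1 + 2 ^ l * M / (R - R')
  have hA1 : 1 ≤ A := by
    have : 0 ≤ 2 ^ l * M / (R - R') := div_nonneg (by positivity) (by linarith)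
    simp only [A]; linarith
  have hA0 : 0 < A := by linarith
  have hAM : 2 ^ l * M ≤ (R - R') * A := by
    have : 0 < R - R' := by linarith
    simp only [A]
    rw [mul_add, mul_div_cancel₀ _ this.ne']; linarith
  refine ⟨A, hA1, fun n => ?_⟩
  have hsm : ∀ n : ℕ, ContDiff ℝ ∞ (fun y => p y ^ n) := fun n => (p.smooth ⊤).pow n
  induction n with
  | zero =>
    intro j _ x
    rcases Nat.eq_zero_or_pos j with rfl | h
    · simp
    · simp only [pow_zero]
      rw [iteratedFDeriv_const_of_ne h.ne']
      simp only [Pi.zero_apply, norm_zero]; positivity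
  | succ n ih =>
    intro j hj x
    simp only [pow_succ]
    refine (norm_iteratedFDeriv_mul_le (N := j) (contDiff_coe_of_infty (hsm n) j)
      (p.smooth j) x le_rfl).trans ?_
    -- In the Leibniz sum for `pⁿ · p`, the term with all derivatives on `pⁿ` contributes the factor
    -- `R'`. Every other term puts at most `j - 1` derivatives on `pⁿ`, so the spare factor `A` pays
    -- for it, and together these terms contribute `R - R'`.
    rw [Finset.sum_range_succ, Nat.choose_self, Nat.sub_self, norm_iteratedFDeriv_zero]
    have h1 : ((1 : ℕ) : ℝ) * ‖iteratedFDeriv ℝ j (fun y => p y ^ n) x‖ * ‖p x‖ ≤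
        A ^ j * R ^ n * R' := by
      rw [Nat.cast_one, one_mul]
      exact mul_le_mul (ih j hj x) (hp x) (norm_nonneg _) (by positivity)
    have h2 : ∑ i ∈ Finset.range j, (j.choose i : ℝ) *
        ‖iteratedFDeriv ℝ i (fun y => p y ^ n) x‖ * ‖iteratedFDeriv ℝ (j - i) p x‖ ≤
        A ^ j * R ^ n * (R - R') := by
      rcases Nat.eq_zero_or_pos j with rfl | hj0
      · simp only [Finset.range_zero, Finset.sum_empty]
        exact mul_nonneg (by positivity) (by linarith)
      have h3 : ∀ i ∈ Finset.range j, (j.choose i : ℝ) *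
          ‖iteratedFDeriv ℝ i (fun y => p y ^ n) x‖ * ‖iteratedFDeriv ℝ (j - i) p x‖ ≤
          (j.choose i : ℝ) * (A ^ (j - 1) * R ^ n * M) := by
        intro i hi
        have hi := Finset.mem_range.1 hi
        rw [mul_assoc]
        refine mul_le_mul_of_nonneg_left ?_ (Nat.cast_nonneg _)
        refine mul_le_mul ((ih i (by omega) x).trans ?_) (hM _ (by omega) x) (norm_nonneg _)
          (by positivity)
        exact mul_le_mul_of_nonneg_right (pow_le_pow_right₀ hA1 (by omega)) (by positivity)
      have h4 : ∑ i ∈ Finset.range j, (j.choose i : ℝ) ≤ 2 ^ l := by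
        have h5 : ∑ i ∈ Finset.range j, (j.choose i : ℝ) ≤
            ∑ i ∈ Finset.range (j + 1), (j.choose i : ℝ) :=
          Finset.sum_le_sum_of_subset_of_nonneg
            (Finset.range_subset_range.2 (by omega)) (fun _ _ _ => Nat.cast_nonneg _)
        rw [← Nat.cast_sum (Finset.range (j + 1)), Nat.sum_range_choose] at h5
        push_cast at h5
        exact h5.trans (pow_le_pow_right₀ (by norm_num) hj)
      calc _ ≤ ∑ i ∈ Finset.range j, (j.choose i : ℝ) * (A ^ (j - 1) * R ^ n * M) :=
            Finset.sum_le_sum h3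
        _ = (∑ i ∈ Finset.range j, (j.choose i : ℝ)) * (A ^ (j - 1) * R ^ n * M) := by
            rw [Finset.sum_mul]
        _ ≤ 2 ^ l * (A ^ (j - 1) * R ^ n * M) :=
            mul_le_mul_of_nonneg_right h4 (by positivity)
        _ = A ^ (j - 1) * R ^ n * (2 ^ l * M) := by ring
        _ ≤ A ^ (j - 1) * R ^ n * ((R - R') * A) :=
            mul_le_mul_of_nonneg_left hAM (by positivity)
        _ = A ^ (j - 1 + 1) * R ^ n * (R - R') := by ring
        _ = _ := by rw [Nat.sub_add_cancel hj0]
    calc _ ≤ A ^ j * R ^ n * (R - R') + A ^ j * R ^ n * R' := add_le_add h2 h1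
      _ = _ := by ring

/-- A single Schwartz seminorm of `χ pⁿ φ`. -/
theorem exists_seminorm_mul_pow_mul_le (χ p : 𝓢(E, ℂ)) {R' R : ℝ} (hp : ∀ x, ‖p x‖ ≤ R')
    (hR : R' < R) (k l : ℕ) :
    ∃ C, 0 ≤ C ∧ ∀ (n : ℕ) (φ ψ : 𝓢(E, ℂ)) (B : ℝ), (∀ x, ψ x = χ x * p x ^ n * φ x) →
      (∀ j ≤ l, ∀ x, ‖iteratedFDeriv ℝ j φ x‖ ≤ B) →
      SchwartzMap.seminorm ℝ k l ψ ≤ C * R ^ n * B := by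
  obtain ⟨A, hA1, hA⟩ := exists_norm_iteratedFDeriv_pow_le p hp hR l
  have hR0 : 0 < R := ((norm_nonneg _).trans (hp 0)).trans_lt hR
  let M : ℝ := ∑ i ∈ Finset.range (l + 1), SchwartzMap.seminorm ℝ k i χ
  have hM0 : 0 ≤ M := by positivity
  have hM : ∀ i ≤ l, ∀ x, ‖x‖ ^ k * ‖iteratedFDeriv ℝ i χ x‖ ≤ M := fun i hi x =>
    (χ.le_seminorm ℝ k i x).trans
      (Finset.single_le_sum (f := fun i => SchwartzMap.seminorm ℝ k i χ)
        (fun _ _ => apply_nonneg _ _) (Finset.mem_range.2 (by omega)))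
  have hA0 : 0 < A := by linarith
  -- One factor `2 ^ l` for each of the two uses of the Leibniz rule, in `χ · pⁿ` and in `(χ pⁿ) ·
  -- φ`.
  refine ⟨2 ^ l * (2 ^ l * M * A ^ l), by positivity, fun n φ ψ B hψ hB => ?_⟩
  have hB0 : 0 ≤ B := (norm_nonneg _).trans (hB 0 (Nat.zero_le _) 0)
  have hsp : ∀ j : ℕ, ContDiff ℝ j (fun y => p y ^ n) := fun j => (p.smooth j).pow n
  refine SchwartzMap.seminorm_le_bound ℝ k l ψ (by positivity) fun x => ?_
  have h1 : ∀ j ≤ l, ‖x‖ ^ k * ‖iteratedFDeriv ℝ j (fun y => χ y * p y ^ n) x‖ ≤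
      2 ^ l * M * (A ^ l * R ^ n) := by
    intro j hj
    calc _ ≤ ‖x‖ ^ k * ∑ i ∈ Finset.range (j + 1), (j.choose i : ℝ) *
          ‖iteratedFDeriv ℝ i χ x‖ * ‖iteratedFDeriv ℝ (j - i) (fun y => p y ^ n) x‖ :=
          mul_le_mul_of_nonneg_left (norm_iteratedFDeriv_mul_le (N := j) (χ.smooth j) (hsp j) x
            le_rfl) (by positivity)
      _ = ∑ i ∈ Finset.range (j + 1), (j.choose i : ℝ) *
          (‖x‖ ^ k * ‖iteratedFDeriv ℝ i χ x‖) *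
            ‖iteratedFDeriv ℝ (j - i) (fun y => p y ^ n) x‖ := by
          rw [Finset.mul_sum]; exact Finset.sum_congr rfl fun i _ => by ring
      _ ≤ 2 ^ j * M * (A ^ l * R ^ n) :=
          sum_choose_mul_le (b := fun i => ‖iteratedFDeriv ℝ i (fun y => p y ^ n) x‖) hM0
            (fun i hi => hM i (by omega) x)
            (fun i hi => (hA n i (by omega) x).trans (mul_le_mul_of_nonneg_right
              (pow_le_pow_right₀ hA1 (by omega)) (by positivity)))
            (fun i => norm_nonneg _)
      _ ≤ _ := by
          gcongr
          norm_num
  have hψ' : (ψ : E → ℂ) = fun x => χ x * p x ^ n * φ x := funext hψ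
  rw [hψ']
  calc _ ≤ ‖x‖ ^ k * ∑ i ∈ Finset.range (l + 1), (l.choose i : ℝ) *
        ‖iteratedFDeriv ℝ i (fun y => χ y * p y ^ n) x‖ * ‖iteratedFDeriv ℝ (l - i) φ x‖ :=
        mul_le_mul_of_nonneg_left (norm_iteratedFDeriv_mul_le (N := l) ((χ.smooth l).mul (hsp l))
          (φ.smooth l) x le_rfl) (by positivity)
    _ = ∑ i ∈ Finset.range (l + 1), (l.choose i : ℝ) *
        (‖x‖ ^ k * ‖iteratedFDeriv ℝ i (fun y => χ y * p y ^ n) x‖) *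
          ‖iteratedFDeriv ℝ (l - i) φ x‖ := by
        rw [Finset.mul_sum]; exact Finset.sum_congr rfl fun i _ => by ring
    _ ≤ 2 ^ l * (2 ^ l * M * (A ^ l * R ^ n)) * B :=
        sum_choose_mul_le (b := fun i => ‖iteratedFDeriv ℝ i φ x‖) (by positivity) h1
          (fun i hi => hB i hi x) (fun i => norm_nonneg _)
    _ = _ := by ring

/-- A continuous seminorm of `χ pⁿ φ` grows at most like `Rⁿ`, uniformly for `φ` with bounded
derivatives up to some order. -/
theorem exists_continuous_seminorm_mul_pow_mul_le (Q : Seminorm ℝ 𝓢(E, ℂ)) (hQ : Continuous Q)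
    (χ p : 𝓢(E, ℂ)) {R' R : ℝ} (hp : ∀ x, ‖p x‖ ≤ R') (hR : R' < R) :
    ∃ (C : ℝ) (l : ℕ), 0 ≤ C ∧ ∀ (n : ℕ) (φ ψ : 𝓢(E, ℂ)) (B : ℝ),
      (∀ x, ψ x = χ x * p x ^ n * φ x) →
      (∀ j ≤ l, ∀ x, ‖iteratedFDeriv ℝ j φ x‖ ≤ B) → Q ψ ≤ C * R ^ n * B := by
  obtain ⟨s, D, -, hD⟩ := Seminorm.bound_of_continuous (schwartz_withSeminorms ℝ E ℂ) Q hQ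
  choose C hC0 hC using fun i : ℕ × ℕ => exists_seminorm_mul_pow_mul_le χ p hp hR i.1 i.2
  have hR0 : 0 < R := ((norm_nonneg _).trans (hp 0)).trans_lt hR
  refine ⟨D * ∑ i ∈ s, C i, s.sup Prod.snd, ?_, fun n φ ψ B hψ hB => ?_⟩
  · have := Finset.sum_nonneg fun i (_ : i ∈ s) => hC0 i
    positivity
  · have hB0 : 0 ≤ B := (norm_nonneg _).trans (hB 0 (Nat.zero_le _) 0)
    have hsum : ∀ i ∈ s, C i ≤ ∑ i ∈ s, C i := fun i hi =>
      Finset.single_le_sum (fun i _ => hC0 i) hi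
    have h1 : s.sup (schwartzSeminormFamily ℝ E ℂ) ψ ≤ (∑ i ∈ s, C i) * R ^ n * B := by
      refine Seminorm.finset_sup_apply_le ?_ fun i hi => ?_
      · have := Finset.sum_nonneg fun i (_ : i ∈ s) => hC0 i
        positivity
      · refine (hC i n φ ψ B hψ fun j hj => hB j
          (hj.trans (Finset.le_sup (f := Prod.snd) hi))).trans ?_
        have := hsum i hi
        gcongr
    calc Q ψ ≤ D * s.sup (schwartzSeminormFamily ℝ E ℂ) ψ := hD ψ
      _ ≤ D * ((∑ i ∈ s, C i) * R ^ n * B) := mul_le_mul_of_nonneg_left h1 D.2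
      _ = _ := by ring

end Powers

/-! ### Differential operators as multiplication by symbols on the Fourier side -/

section Symbols

variable {d : ℕ}

theorem fourierS_eq (φ : 𝓢(Rd d, ℂ)) :
    fourierS d φ = (((2 * Real.pi) ^ (-(d : ℝ) / 2) : ℝ) : ℂ) •
      SchwartzMap.compCLMOfContinuousLinearEquiv ℂ (dilation d) (𝓕 φ) := rfl

theorem fourier_constant_ne_zero (d : ℕ) : (((2 * Real.pi) ^ (-(d : ℝ) / 2) : ℝ) : ℂ) ≠ 0 := by
  have : (2 * Real.pi) ^ (-(d : ℝ) / 2) ≠ 0 := (by positivity : (0:ℝ) < _).ne'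
  exact_mod_cast this

/-- The inverse of the Fourier transform `fourierS`. -/
def fourierSInv (d : ℕ) (φ : 𝓢(Rd d, ℂ)) : 𝓢(Rd d, ℂ) :=
  𝓕⁻ ((((2 * Real.pi) ^ (-(d : ℝ) / 2) : ℝ) : ℂ)⁻¹ •
    SchwartzMap.compCLMOfContinuousLinearEquiv ℂ (dilation d).symm φ)

theorem fourierS_fourierSInv (φ : 𝓢(Rd d, ℂ)) : fourierS d (fourierSInv d φ) = φ := by
  rw [fourierS_eq, fourierSInv, FourierTransform.fourier_fourierInv_eq]
  ext x
  simp [mul_inv_cancel_left₀ (fourier_constant_ne_zero d)]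

theorem fourierSInv_fourierS (φ : 𝓢(Rd d, ℂ)) : fourierSInv d (fourierS d φ) = φ := by
  rw [fourierS_eq, fourierSInv]
  have : (((2 * Real.pi) ^ (-(d : ℝ) / 2) : ℝ) : ℂ)⁻¹ •
    SchwartzMap.compCLMOfContinuousLinearEquiv ℂ (dilation d).symm
      ((((2 * Real.pi) ^ (-(d : ℝ) / 2) : ℝ) : ℂ) •
      SchwartzMap.compCLMOfContinuousLinearEquiv ℂ (dilation d) (𝓕 φ)) = 𝓕 φ := by
    ext x
    simp [inv_mul_cancel_left₀ (fourier_constant_ne_zero d)]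
  rw [this, FourierTransform.fourierInv_fourier_eq]

/-- The coordinate symbol `i ξ_j`. -/
def coordSymbol (j : Fin d) : Rd d → ℂ := fun ξ => Complex.I * ((ξ j : ℝ) : ℂ)

theorem hasTemperateGrowth_coordSymbol (j : Fin d) : (coordSymbol j).HasTemperateGrowth := by
  have h1 : (fun ξ : Rd d => ((ξ j : ℝ) : ℂ)).HasTemperateGrowth :=
    (Complex.ofRealCLM.comp (EuclideanSpace.proj (𝕜 := ℝ) j)).hasTemperateGrowth
  exact (Function.HasTemperateGrowth.const Complex.I).mul h1

/-- The dilation by `(2π)⁻¹` cancels the `2π` that differentiating the kernel `e^{-2πi x·ξ}`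
produces. -/
theorem fourierS_coordSymbol_mul (j : Fin d) (ψ : 𝓢(Rd d, ℂ)) :
    fourierS d (SchwartzMap.smulLeftCLM ℂ (coordSymbol j) ψ) =
      -∂_{EuclideanSpace.single j (1 : ℝ)} (fourierS d ψ) := by
  have h2 : dilation d (EuclideanSpace.single j (1 : ℝ)) =
      (2 * Real.pi)⁻¹ • EuclideanSpace.single j (1 : ℝ) := rfl
  have htg : (fun ξ : Rd d => inner ℝ ξ (EuclideanSpace.single j (1 : ℝ))).HasTemperateGrowth := by
    fun_prop
  rw [fourierS_eq, fourierS_eq, lineDerivOp_smul,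
    SchwartzMap.lineDerivOp_compCLMOfContinuousLinearEquiv, h2, lineDerivOp_left_smul,
    SchwartzMap.lineDerivOp_fourier_eq]
  have h3 : SchwartzMap.smulLeftCLM ℂ (coordSymbol j) ψ = -((2 * Real.pi)⁻¹ : ℝ) •
      (-(2 * Real.pi * Complex.I) • SchwartzMap.smulLeftCLM ℂ
        (fun ξ : Rd d => inner ℝ ξ (EuclideanSpace.single j (1 : ℝ))) ψ) := by
    ext ξ
    have hpi : (Real.pi : ℂ) ≠ 0 := by exact_mod_cast Real.pi_ne_zero
    have h4 := SchwartzMap.smulLeftCLM_apply_apply (F := ℂ) htg ψ ξ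
    simp only [EuclideanSpace.inner_single_right, one_mul, conj_trivial, Complex.real_smul] at h4
    simp [SchwartzMap.smulLeftCLM_apply_apply (hasTemperateGrowth_coordSymbol j),
      coordSymbol, EuclideanSpace.inner_single_right, h4]
    field_simp
  rw [h3]
  ext ξ
  simp

/-- `g` is a smooth function representing the tempered distribution obtained from `T` by
multiplying its Fourier transform by the symbol `σ`. -/
structure HasSymbol (T : 𝓢'(Rd d, ℂ)) (σ : Rd d → ℂ) (g : Rd d → ℂ) : Prop where
  smooth : ContDiff ℝ ∞ g
  growth : σ.HasTemperateGrowth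
  apply_eq : ∀ φ : 𝓢(Rd d, ℂ), HasCompactSupport φ →
    T (fourierS d (SchwartzMap.smulLeftCLM ℂ σ (fourierSInv d φ))) = ∫ x, g x * φ x

namespace HasSymbol

variable {T : 𝓢'(Rd d, ℂ)} {σ : Rd d → ℂ} {g : Rd d → ℂ}

theorem of_represents (hg : ContDiff ℝ ∞ g) (hT : Represents g T) : HasSymbol T (fun _ => 1) g := by
  refine ⟨hg, Function.HasTemperateGrowth.const 1, fun φ hφ => ?_⟩
  rw [SchwartzMap.smulLeftCLM_const, ← hT φ hφ]
  simp [fourierS_fourierSInv]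

theorem integrable_mul (hg : Continuous g) {φ : 𝓢(Rd d, ℂ)} (hφ : HasCompactSupport φ) :
    Integrable fun x => g x * φ x :=
  (hg.mul φ.continuous).integrable_of_hasCompactSupport hφ.mul_left

theorem contDiff_partialDeriv (hg : ContDiff ℝ ∞ g) (j : Fin d) :
    ContDiff ℝ ∞ (partialDeriv j g) :=
  (hg.fderiv_right (m := ∞) (by simp)).clm_apply contDiff_const

/-- Integration by parts, without boundary terms since `φ` has compact support; its sign cancels the
one in `fourierS_coordSymbol_mul`. -/
theorem partialDeriv (h : HasSymbol T σ g) (j : Fin d) :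
    HasSymbol T (fun ξ => σ ξ * coordSymbol j ξ) (partialDeriv j g) := by
  have hc := hasTemperateGrowth_coordSymbol (d := d) j
  refine ⟨contDiff_partialDeriv h.smooth j, h.growth.mul hc, fun φ hφ => ?_⟩
  let v : Rd d := EuclideanSpace.single j (1 : ℝ)
  have hφ' : HasCompactSupport (∂_{v} φ : 𝓢(Rd d, ℂ)) :=
    hφ.of_isClosed_subset isClosed_closure (tsupport_fderiv_apply_subset ℝ v)
  have h1 : SchwartzMap.smulLeftCLM ℂ (coordSymbol j) (fourierSInv d φ) =
      fourierSInv d (-∂_{v} φ) := by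
    rw [← fourierSInv_fourierS (SchwartzMap.smulLeftCLM ℂ (coordSymbol j) (fourierSInv d φ)),
      fourierS_coordSymbol_mul, fourierS_fourierSInv]
  have hneg : HasCompactSupport ((-∂_{v} φ : 𝓢(Rd d, ℂ)) : Rd d → ℂ) := by
    have : ((-∂_{v} φ : 𝓢(Rd d, ℂ)) : Rd d → ℂ) = -((∂_{v} φ : 𝓢(Rd d, ℂ)) : Rd d → ℂ) := rfl
    rw [this]
    exact hφ'.neg
  have h2 := SchwartzMap.smulLeftCLM_smulLeftCLM_apply (F := ℂ) h.growth hc (fourierSInv d φ)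
  have h2' : SchwartzMap.smulLeftCLM ℂ (fun ξ => σ ξ * coordSymbol j ξ) (fourierSInv d φ) =
      SchwartzMap.smulLeftCLM ℂ σ (fourierSInv d (-∂_{v} φ)) := by
    rw [← h1, h2]; rfl
  rw [h2', h.apply_eq _ hneg]
  have hd : Differentiable ℝ g := h.smooth.differentiable (by simp)
  have h3 := integral_mul_fderiv_eq_neg_fderiv_mul_of_integrable (μ := volume) (f := g)
    (g := (φ : Rd d → ℂ)) (v := v)
    (integrable_mul (contDiff_partialDeriv h.smooth j).continuous hφ)
    (integrable_mul h.smooth.continuous hφ')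
    (integrable_mul h.smooth.continuous hφ)
    (fun x _ => hd x) (fun x _ => φ.differentiable x)
  have h4 : ∀ x, g x * (-∂_{v} φ : 𝓢(Rd d, ℂ)) x = -(g x * fderiv ℝ φ x v) := fun x => by
    simp [SchwartzMap.lineDerivOp_apply_eq_fderiv]
  simp only [h4]
  rw [integral_neg, h3, neg_neg]
  rfl

theorem iterate_partialDeriv (h : HasSymbol T σ g) (j : Fin d) (k : ℕ) :
    HasSymbol T (fun ξ => σ ξ * coordSymbol j ξ ^ k) ((RealPaleyWiener.partialDeriv j)^[k] g) := by
  induction k with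
  | zero => simpa using h
  | succ k ih =>
    rw [Function.iterate_succ_apply']
    simpa only [pow_succ, mul_assoc] using ih.partialDeriv j

theorem foldr_partialDeriv (h : HasSymbol T σ g) (m : Fin d →₀ ℕ) (L : List (Fin d)) :
    HasSymbol T (fun ξ => σ ξ * (L.map fun j => coordSymbol j ξ ^ m j).prod)
      (L.foldr (fun j f => (RealPaleyWiener.partialDeriv j)^[m j] f) g) := by
  induction L with
  | nil => simpa using h
  | cons j L ih =>
    have := ih.iterate_partialDeriv j (m j)
    simp only [List.map_cons, List.prod_cons, List.foldr_cons]
    convert this using 2 with ξ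
    ring

theorem multiDeriv (h : HasSymbol T σ g) (m : Fin d →₀ ℕ) :
    HasSymbol T (fun ξ => σ ξ * ∏ j, coordSymbol j ξ ^ m j) (multiDeriv m g) := by
  have := h.foldr_partialDeriv m (List.finRange d)
  convert this using 3 with ξ
  swap
  · rfl
  rw [← List.ofFn_eq_map, List.prod_ofFn]

theorem const_mul (h : HasSymbol T σ g) (c : ℂ) :
    HasSymbol T (fun ξ => σ ξ * c) (fun x => c * g x) := by
  refine ⟨contDiff_const.mul h.smooth, h.growth.mul (Function.HasTemperateGrowth.const c),
    fun φ hφ => ?_⟩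
  have : SchwartzMap.smulLeftCLM ℂ (fun ξ => σ ξ * c) (fourierSInv d φ) =
      c • SchwartzMap.smulLeftCLM ℂ σ (fourierSInv d φ) := by
    ext ξ
    have htg : Function.HasTemperateGrowth fun ξ => σ ξ * c :=
      h.growth.mul (Function.HasTemperateGrowth.const c)
    rw [SchwartzMap.smulLeftCLM_apply_apply htg, smul_apply, SchwartzMap.smulLeftCLM_apply_apply h.growth]
    simp only [smul_eq_mul]
    ring
  rw [this, map_smul, map_smul, h.apply_eq φ hφ, smul_eq_mul, ← integral_const_mul]
  simp only [mul_assoc]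

theorem sum {ι : Type*} (s : Finset ι) {τ : ι → Rd d → ℂ} {G : ι → Rd d → ℂ}
    (h : ∀ i ∈ s, HasSymbol T (τ i) (G i)) :
    HasSymbol T (fun ξ => ∑ i ∈ s, τ i ξ) (fun x => ∑ i ∈ s, G i x) := by
  have htg : Function.HasTemperateGrowth fun ξ => ∑ i ∈ s, τ i ξ :=
    Function.HasTemperateGrowth.sum fun i hi => (h i hi).growth
  refine ⟨ContDiff.sum fun i hi => (h i hi).smooth, htg, fun φ hφ => ?_⟩
  rw [SchwartzMap.smulLeftCLM_sum fun i hi => (h i hi).growth]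
  simp only [sum_apply, map_sum, Finset.sum_mul]
  rw [integral_finsetSum _ fun i hi => integrable_mul (h i hi).smooth.continuous hφ]
  exact Finset.sum_congr rfl fun i hi => (h i hi).apply_eq φ hφ

theorem diffOp (h : HasSymbol T σ g) (P : MvPolynomial (Fin d) ℂ) :
    HasSymbol T (fun ξ => σ ξ * evalI P ξ) (diffOp P g) := by
  have := HasSymbol.sum P.support fun m _ => (h.multiDeriv m).const_mul (P.coeff m)
  convert this using 2 with ξ
  swap
  · rfl
  rw [evalI, MvPolynomial.eval_eq', Finset.mul_sum]
  exact Finset.sum_congr rfl fun m _ => by simp only [coordSymbol]; ring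

theorem iterate_diffOp (h : HasSymbol T (fun _ => 1) g) (P : MvPolynomial (Fin d) ℂ) (n : ℕ) :
    HasSymbol T (fun ξ => evalI P ξ ^ n) ((RealPaleyWiener.diffOp P)^[n] g) := by
  induction n with
  | zero => simpa using h
  | succ n ih =>
    rw [Function.iterate_succ_apply']
    simpa only [pow_succ] using ih.diffOp P

end HasSymbol

end Symbols

/-! ### The two inequalities between growth exponent and support radius -/

section Estimates

variable {d : ℕ}

theorem continuous_fourierSInv (d : ℕ) : Continuous (fourierSInv d) :=
  (FourierTransform.fourierInvCLM ℂ 𝓢(Rd d, ℂ)).continuous.comp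
    ((SchwartzMap.compCLMOfContinuousLinearEquiv ℂ (dilation d).symm).continuous.const_smul
      (((2 * Real.pi) ^ (-(d : ℝ) / 2) : ℝ) : ℂ)⁻¹)

theorem hasTemperateGrowth_evalI (P : MvPolynomial (Fin d) ℂ) : (evalI P).HasTemperateGrowth := by
  induction P using MvPolynomial.induction_on with
  | C a =>
    have : evalI (MvPolynomial.C a : MvPolynomial (Fin d) ℂ) = fun _ => a := by
      ext ξ; simp [evalI]
    rw [this]; exact Function.HasTemperateGrowth.const a
  | add p q hp hq =>
    have : evalI (p + q) = fun ξ => evalI p ξ + evalI q ξ := by ext ξ; simp [evalI]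
    rw [this]; exact hp.add hq
  | mul_X p j hp =>
    have : evalI (p * MvPolynomial.X j) = fun ξ => evalI p ξ * coordSymbol j ξ := by
      ext ξ; simp [evalI, coordSymbol]
    rw [this]; exact hp.mul (hasTemperateGrowth_coordSymbol j)

theorem contDiff_evalI (P : MvPolynomial (Fin d) ℂ) : ContDiff ℝ ∞ (evalI P) :=
  (hasTemperateGrowth_evalI P).1

theorem continuous_evalI (P : MvPolynomial (Fin d) ℂ) : Continuous (evalI P) :=
  (contDiff_evalI P).continuous

/-- The derivatives of the inverse Fourier transform of an `L¹`-normalized test function supported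
near `x` grow polynomially in `x`. -/
theorem exists_norm_iteratedFDeriv_fourierSInv_le (d l : ℕ) :
    ∃ C, 0 ≤ C ∧ ∀ (x : Rd d) (φ : 𝓢(Rd d, ℂ)), (∀ y, φ y ≠ 0 → ‖y‖ ≤ 1 + ‖x‖) →
      ∫ y, ‖φ y‖ = 1 → ∀ j ≤ l, ∀ ξ,
        ‖iteratedFDeriv ℝ j (fourierSInv d φ) ξ‖ ≤ C * (1 + ‖x‖) ^ l := by
  let c : ℂ := (((2 * Real.pi) ^ (-(d : ℝ) / 2) : ℝ) : ℂ)⁻¹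
  -- The `L¹` norm of `h` below: the normalizing constant times the Jacobian of `v ↦ -2πv`.
  let D : ℝ := ‖c‖ * |((-(2 * Real.pi)) ^ d)⁻¹|
  refine ⟨(2 * Real.pi) ^ l * ((l + 1) * D), by positivity, fun x φ hφ hint j hj ξ => ?_⟩
  let r := 1 + ‖x‖
  have hr1 : 1 ≤ r := by simp [r]
  let F : 𝓢(Rd d, ℂ) := c • SchwartzMap.compCLMOfContinuousLinearEquiv ℂ (dilation d).symm φ
  -- The reflection turns the inverse transform into a forward one, whose derivatives are controlled
  -- by the moments of `h`.
  let h : 𝓢(Rd d, ℂ) :=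
    SchwartzMap.compCLMOfContinuousLinearEquiv ℂ (ContinuousLinearEquiv.neg ℝ) F
  have hh : ∀ v, h v = c * φ ((-(2 * Real.pi)) • v) := fun v => by
    have : (dilation d).symm (-v) = (-(2 * Real.pi)) • v := by
      rw [ContinuousLinearEquiv.symm_apply_eq]
      change -v = (2 * Real.pi)⁻¹ • (-(2 * Real.pi)) • v
      rw [smul_smul, mul_neg, inv_mul_cancel₀ (by positivity), neg_one_smul]
    simp [h, F, ← this]
  have hinv : (fourierSInv d φ : Rd d → ℂ) = 𝓕 (h : Rd d → ℂ) := by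
    have h1 : fourierSInv d φ = 𝓕⁻ F := rfl
    rw [h1, SchwartzMap.fourierInv_coe]
    ext w
    rw [Real.fourierInv_eq_fourier_comp_neg]
    rfl
  have hL1 : ∫ v, ‖h v‖ = D := by
    have h1 : ∀ v, ‖h v‖ = ‖c‖ * ‖φ ((-(2 * Real.pi)) • v)‖ := fun v => by rw [hh, norm_mul]
    simp only [h1]
    rw [integral_const_mul, Measure.integral_comp_smul volume (fun y => ‖φ y‖), hint]
    simp [D]
  have hsupp : ∀ v, h v ≠ 0 → ‖v‖ ≤ r := fun v hv => by
    have h1 := hφ ((-(2 * Real.pi)) • v) fun h0 => hv (by rw [hh, h0, mul_zero])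
    rw [norm_smul, norm_neg, Real.norm_of_nonneg (by positivity)] at h1
    have := Real.pi_gt_three
    nlinarith [norm_nonneg v]
  have hi : ∀ i ≤ j, ∫ v, ‖v‖ ^ i * ‖h v‖ ≤ r ^ l * D := fun i hi => by
    rw [← hL1, ← integral_const_mul]
    refine integral_mono (h.integrable_pow_mul volume i) (h.integrable.norm.const_mul _) fun v => ?_
    by_cases hv : h v = 0
    · simp [hv]
    · refine mul_le_mul_of_nonneg_right ?_ (norm_nonneg _)
      exact (pow_le_pow_left₀ (norm_nonneg _) (hsupp v hv) i).trans
        (pow_le_pow_right₀ hr1 (by omega))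
  have key := Real.pow_mul_norm_iteratedFDeriv_fourier_le (f := (h : Rd d → ℂ)) (K := j) (N := 0)
    (by exact_mod_cast h.smooth 0) (fun k n _ _ => h.integrable_pow_mul_iteratedFDeriv volume k n)
    (k := j) (n := 0) le_rfl le_rfl ξ
  rw [hinv]
  rw [pow_zero, one_mul, pow_zero, mul_one, Finset.sum_product] at key
  simp only [zero_add, Finset.range_one, Finset.sum_singleton, norm_iteratedFDeriv_zero] at key
  have hsum : ∑ i ∈ Finset.range (j + 1), ∫ v, ‖v‖ ^ i * ‖h v‖ ≤ (l + 1) * (r ^ l * D) := by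
    refine (Finset.sum_le_card_nsmul _ _ (r ^ l * D) fun i hi' =>
      hi i (by have := Finset.mem_range.1 hi'; omega)).trans ?_
    rw [Finset.card_range, nsmul_eq_mul]
    refine mul_le_mul_of_nonneg_right ?_ (by positivity)
    push_cast
    have : (j : ℝ) ≤ l := by exact_mod_cast hj
    linarith
  have h2pi : (1 : ℝ) ≤ 2 * Real.pi := by have := Real.pi_gt_three; linarith
  calc _ ≤ (2 * Real.pi) ^ j * ∑ i ∈ Finset.range (j + 1), ∫ v, ‖v‖ ^ i * ‖h v‖ := key
    _ ≤ (2 * Real.pi) ^ l * ((l + 1) * (r ^ l * D)) :=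
        mul_le_mul (pow_le_pow_right₀ h2pi hj) hsum
          (Finset.sum_nonneg fun i _ => integral_nonneg fun v => by positivity) (by positivity)
    _ = _ := by simp only [r]; ring

/-- A continuous function is bounded at `x` by its averages against test functions near `x`. -/
theorem norm_le_of_forall_norm_integral_le {g : Rd d → ℂ} (hg : Continuous g) (x : Rd d) (M : ℝ)
    (h : ∀ φ : 𝓢(Rd d, ℂ), HasCompactSupport φ → (∀ y, φ y ≠ 0 → ‖y‖ ≤ 1 + ‖x‖) →
      ∫ y, ‖φ y‖ = 1 → ‖∫ y, g y * φ y‖ ≤ M) : ‖g x‖ ≤ M := by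
  refine le_of_forall_pos_le_add fun ε hε => ?_
  obtain ⟨δ, hδ, hgδ⟩ := Metric.continuousAt_iff.1 hg.continuousAt ε hε
  -- Radius at most `δ` for the continuity estimate, and at most `1` so that the support lies in the
  -- ball of radius `1 + ‖x‖`.
  let b : ContDiffBump x := ⟨min δ 1 / 2, min δ 1, by positivity, half_lt_self (by positivity)⟩
  let β : Rd d → ℂ := fun y => (b.normed volume y : ℂ)
  have hβc : HasCompactSupport β :=
    b.hasCompactSupport_normed.comp_left (g := fun r : ℝ => (r : ℂ)) (by simp)
  have hβs : ContDiff ℝ ∞ β := Complex.ofRealCLM.contDiff.comp b.contDiff_normed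
  let φ : 𝓢(Rd d, ℂ) := hβc.toSchwartzMap hβs
  have hφ : ∀ y, φ y = (b.normed volume y : ℂ) := fun y => rfl
  have hφn : ∀ y, ‖φ y‖ = b.normed volume y := fun y => by
    rw [hφ, Complex.norm_real, Real.norm_of_nonneg (b.nonneg_normed y)]
  have hφ1 : ∫ y, ‖φ y‖ = 1 := by simp only [hφn]; exact b.integral_normed
  have hφ1' : ∫ y, φ y = 1 := by
    simp only [hφ]
    rw [integral_complex_ofReal, b.integral_normed, Complex.ofReal_one]
  have hball : ∀ y, φ y ≠ 0 → dist y x < min δ 1 := fun y hy => by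
    have : y ∈ Function.support (b.normed volume) := fun h0 => hy (by rw [hφ, h0]; simp)
    rw [b.support_normed_eq] at this
    exact this
  have h1 := h φ hβc (fun y hy => by
    have h2 := (hball y hy).trans_le (min_le_right _ _)
    have h3 := norm_le_norm_add_norm_sub x y
    rw [← dist_eq_norm, dist_comm] at h3
    linarith) hφ1
  have hint : Integrable fun y => g y * φ y := HasSymbol.integrable_mul hg hβc
  have h4 : ∫ y, (g x - g y) * φ y = g x - ∫ y, g y * φ y := by
    simp only [sub_mul]
    rw [integral_sub (φ.integrable.const_mul _) hint, integral_const_mul, hφ1', mul_one]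
  have h5 : ‖∫ y, (g x - g y) * φ y‖ ≤ ε := by
    calc _ ≤ ∫ y, ε * ‖φ y‖ := by
          refine norm_integral_le_of_norm_le (φ.integrable.norm.const_mul ε)
            (Eventually.of_forall fun y => ?_)
          by_cases hy : φ y = 0
          · simp [hy]
          · rw [norm_mul]
            refine mul_le_mul_of_nonneg_right ?_ (norm_nonneg _)
            rw [← dist_eq_norm, dist_comm]
            exact (hgδ ((hball y hy).trans_le (min_le_left _ _))).le
      _ = ε := by rw [integral_const_mul, hφ1, mul_one]
  rw [h4] at h5
  have := norm_le_norm_add_norm_sub (∫ y, g y * φ y) (g x)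
  rw [norm_sub_rev] at this
  linarith [norm_sub_rev (g x) (∫ y, g y * φ y)]

/-- The seminorm `‖U ·‖`. -/
def absSeminorm (U : 𝓢'(Rd d, ℂ)) : Seminorm ℝ 𝓢(Rd d, ℂ) :=
  (normSeminorm ℝ ℂ).comp (U.toLinearMap.restrictScalars ℝ)

theorem absSeminorm_apply (U : 𝓢'(Rd d, ℂ)) (φ : 𝓢(Rd d, ℂ)) : absSeminorm U φ = ‖U φ‖ := rfl

theorem continuous_absSeminorm (U : 𝓢'(Rd d, ℂ)) : Continuous (absSeminorm U) :=
  continuous_norm.comp U.continuous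

theorem norm_evalI_lt_of_supportRadius_lt {P : MvPolynomial (Fin d) ℂ} {S : Set (Rd d)} {R : ℝ≥0}
    (h : supOn P S < R) {ξ : Rd d} (hξ : ξ ∈ S) : ‖evalI P ξ‖ < R := by
  have : ‖evalI P ξ‖ₑ < R := (le_iSup₂ (f := fun ξ _ => ‖evalI P ξ‖ₑ) ξ hξ).trans_lt h
  exact_mod_cast (show ‖evalI P ξ‖₊ < R by exact_mod_cast this)

/-- The strict inequality leaves room for a radius `R'` in between: `R'` bounds the symbol near the
support, and the gap up to `R` absorbs the polynomial growth in `n` from differentiating an `n`th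
power. -/
theorem growthBound_of_supportRadius_lt {f : Rd d → ℂ} {T : 𝓢'(Rd d, ℂ)}
    (hf : HasSymbol T (fun _ => 1) f) (hsupp : IsCompact (Distribution.dsupport (fourierT T)))
    (P : MvPolynomial (Fin d) ℂ) (R : ℝ≥0) (hR : supportRadius P (fourierT T) < R) :
    GrowthBound P f R := by
  obtain ⟨R', hR', hR'R⟩ := ENNReal.lt_iff_exists_nnreal_btwn.1 hR
  have hR'R : (R' : ℝ) < R := by exact_mod_cast hR'R
  let V : Set (Rd d) := {ξ | ‖evalI P ξ‖ < R'}
  have hV : IsOpen V := isOpen_lt (continuous_evalI P).norm continuous_const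
  obtain ⟨χ, hχc, hχV, hχ1, -⟩ := exists_schwartz_cutoff hsupp hV
    fun ξ hξ => norm_evalI_lt_of_supportRadius_lt hR' hξ
  -- Two cutoffs: `θ` makes `p = θ P` bounded by `R'` everywhere, and since `θ = 1` on the support
  -- of `χ`, the product `χ pⁿ` equals `Pⁿ` near the support of the distribution.
  obtain ⟨θ, hθc, hθV, hθ1, hθ⟩ := exists_schwartz_cutoff hχc hV hχV
  let p : 𝓢(Rd d, ℂ) := SchwartzMap.smulLeftCLM ℂ (evalI P) θ
  have hp : ∀ ξ, p ξ = evalI P ξ * θ ξ := fun ξ => by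
    simp [p, SchwartzMap.smulLeftCLM_apply_apply (hasTemperateGrowth_evalI P)]
  have hpR : ∀ ξ, ‖p ξ‖ ≤ R' := fun ξ => by
    rw [hp, norm_mul]
    by_cases hξ : θ ξ = 0
    · simp [hξ]
    · have h1 : ‖evalI P ξ‖ < R' := hθV (subset_tsupport _ hξ)
      calc _ ≤ (R' : ℝ) * 1 := mul_le_mul h1.le (hθ ξ) (norm_nonneg _) R'.2
        _ = _ := mul_one _
  obtain ⟨C, l, hC0, hC⟩ := exists_continuous_seminorm_mul_pow_mul_le (absSeminorm (fourierT T))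
    (continuous_absSeminorm _) χ p hpR hR'R
  obtain ⟨c, hc0, hc⟩ := exists_norm_iteratedFDeriv_fourierSInv_le d l
  refine ⟨l, C * c, by positivity, fun n hn x => ?_⟩
  have hs := hf.iterate_diffOp P n
  -- The estimate holds without a power of `n`; the factor `n ^ l ≥ 1` only fits it to
  -- `GrowthBound`, where one exponent serves both `n` and `1 + ‖x‖`.
  have hn1 : (1 : ℝ) ≤ (n : ℝ) ^ l := one_le_pow₀ (by exact_mod_cast hn)
  suffices h : ‖(diffOp P)^[n] f x‖ ≤ C * R ^ n * (c * (1 + ‖x‖) ^ l) by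
    refine h.trans ?_
    calc C * (R : ℝ) ^ n * (c * (1 + ‖x‖) ^ l) = 1 * (C * (R : ℝ) ^ n * (c * (1 + ‖x‖) ^ l)) := by
          ring
      _ ≤ (n : ℝ) ^ l * (C * (R : ℝ) ^ n * (c * (1 + ‖x‖) ^ l)) :=
          mul_le_mul_of_nonneg_right hn1 (by positivity)
      _ = _ := by ring
  refine norm_le_of_forall_norm_integral_le hs.smooth.continuous x _ fun φ hφc hφx hφ1 => ?_
  have htg : Function.HasTemperateGrowth fun ξ => χ ξ * p ξ ^ n :=
    χ.hasTemperateGrowth.mul (p.hasTemperateGrowth.pow n)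
  let ψ : 𝓢(Rd d, ℂ) := SchwartzMap.smulLeftCLM ℂ (fun ξ => χ ξ * p ξ ^ n) (fourierSInv d φ)
  have hψ : ∀ ξ, ψ ξ = χ ξ * p ξ ^ n * fourierSInv d φ ξ := fun ξ => by
    rw [SchwartzMap.smulLeftCLM_apply_apply htg, smul_eq_mul]
  have heq : fourierT T (SchwartzMap.smulLeftCLM ℂ (fun ξ => evalI P ξ ^ n) (fourierSInv d φ)) =
      fourierT T ψ := by
    refine apply_eq_of_eventuallyEq_nhdsSet_dsupport _ _ _ ?_
    filter_upwards [hχ1] with ξ hξ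
    have hθξ : θ ξ = 1 := hθ1.self_of_nhdsSet ξ (subset_tsupport _ (by simp [hξ]))
    rw [hψ, SchwartzMap.smulLeftCLM_apply_apply hs.growth, hp, hθξ, hξ, smul_eq_mul, one_mul,
      mul_one]
  rw [← hs.apply_eq φ hφc, ← fourierT_apply, heq, ← absSeminorm_apply]
  exact hC n _ ψ _ hψ (hc x φ hφx hφ1)

/-- A tempered distribution represented by a function of polynomial growth is bounded by a
continuous seminorm. -/
theorem exists_seminorm_bound (d N : ℕ) :
    ∃ Q : Seminorm ℝ 𝓢(Rd d, ℂ), Continuous Q ∧ ∀ (L : 𝓢(Rd d, ℂ) → ℂ) (g : Rd d → ℂ) (M : ℝ),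
      Continuous L → 0 ≤ M → (∀ φ : 𝓢(Rd d, ℂ), HasCompactSupport φ → L φ = ∫ x, g x * φ x) →
      (∀ x, ‖g x‖ ≤ M * (1 + ‖x‖) ^ N) → ∀ φ, ‖L φ‖ ≤ M * Q φ := by
  -- The `r` extra powers of `1 + ‖x‖` make the majorant of `g φ` integrable.
  let r := (volume : Measure (Rd d)).integrablePower
  let m : ℕ × ℕ := (N + r, 0)
  let q : Seminorm ℝ 𝓢(Rd d, ℂ) := (Finset.Iic m).sup (schwartzSeminormFamily ℝ (Rd d) ℂ)
  have hq : Continuous q := Seminorm.continuous_finsetSup fun i _ =>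
    (schwartz_withSeminorms ℝ (Rd d) ℂ).continuous_seminorm i
  let I : ℝ := ∫ x : Rd d, (1 + ‖x‖) ^ (-(r : ℝ))
  have hI : 0 ≤ I := integral_nonneg fun x => by positivity
  let a : ℝ≥0 := ⟨2 ^ (N + r) * I, by positivity⟩
  refine ⟨a • q, hq.const_smul a, fun L g M hL hM hLg hg φ => ?_⟩
  have hQ : Continuous (a • q) := hq.const_smul a
  have hbound : ∀ φ : 𝓢(Rd d, ℂ), HasCompactSupport φ → ‖L φ‖ ≤ M * (a • q) φ := fun φ hφ => by
    rw [hLg φ hφ]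
    have hpt : ∀ x, ‖g x * φ x‖ ≤ M * (2 ^ (N + r) * q φ) * (1 + ‖x‖) ^ (-(r : ℝ)) := fun x => by
      have h1 := SchwartzMap.one_add_le_sup_seminorm_apply (𝕜 := ℝ) (m := m) (k := N + r) (n := 0)
        le_rfl le_rfl φ x
      rw [norm_iteratedFDeriv_zero] at h1
      have hx : (0 : ℝ) < 1 + ‖x‖ := by positivity
      rw [norm_mul, Real.rpow_neg hx.le, Real.rpow_natCast, ← div_eq_mul_inv,
        le_div_iff₀ (by positivity)]
      calc ‖g x‖ * ‖φ x‖ * (1 + ‖x‖) ^ r ≤ M * (1 + ‖x‖) ^ N * ‖φ x‖ * (1 + ‖x‖) ^ r := by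
            gcongr; exact hg x
        _ = M * ((1 + ‖x‖) ^ (N + r) * ‖φ x‖) := by ring
        _ ≤ _ := mul_le_mul_of_nonneg_left h1 hM
    have hint : Integrable fun x : Rd d => (1 + ‖x‖) ^ (-(r : ℝ)) :=
      Measure.integrable_pow_neg_integrablePower _
    refine (norm_integral_le_of_norm_le (hint.const_mul _) (Eventually.of_forall hpt)).trans ?_
    rw [integral_const_mul]
    have : (a • q) φ = 2 ^ (N + r) * I * q φ := rfl
    rw [this]
    exact le_of_eq (by ring)
  obtain ⟨u, huc, -, hu⟩ := exists_seq_hasCompactSupport_tendsto φ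
  exact le_of_tendsto_of_tendsto (((hL.tendsto φ).comp hu).norm)
    (((hQ.tendsto φ).comp hu).const_mul M) (Eventually.of_forall fun k => hbound (u k) (huc k))

theorem contDiff_mul_inv_of_tsupport_subset {g P : Rd d → ℂ} (hg : ContDiff ℝ ∞ g)
    (hP : ContDiff ℝ ∞ P) (h : ∀ x ∈ tsupport g, P x ≠ 0) :
    ContDiff ℝ ∞ fun x => g x * (P x)⁻¹ := by
  refine contDiff_iff_contDiffAt.2 fun x => ?_
  by_cases hx : x ∈ tsupport g
  · exact hg.contDiffAt.mul (hP.contDiffAt.inv (h x hx))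
  · have : (fun x => g x * (P x)⁻¹) =ᶠ[𝓝 x] fun _ => 0 := by
      filter_upwards [notMem_tsupport_iff_eventuallyEq.1 hx] with y hy
      simp [hy]
    exact contDiffAt_const.congr_of_eventuallyEq this

/-- Where `|P(iη)|` exceeds `R`, the symbol can be divided out `n` times at a cost smaller than the
gain from the growth bound, so the distribution vanishes there. -/
theorem supportRadius_le_of_growthBound {f : Rd d → ℂ} {T : 𝓢'(Rd d, ℂ)}
    (hf : HasSymbol T (fun _ => 1) f) (P : MvPolynomial (Fin d) ℂ) (R : ℝ≥0)
    (hR : GrowthBound P f R) : supportRadius P (fourierT T) ≤ R := by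
  refine iSup₂_le fun ξ hξ => ?_
  by_contra! hlt
  have hlt : (R : ℝ) < ‖evalI P ξ‖ := by
    have : R < ‖evalI P ξ‖₊ := by exact_mod_cast hlt
    exact_mod_cast this
  -- `R < R₁ < R₂ < |P(iξ)|`: the inverse symbol is at most `R₂⁻¹`, derivatives of its powers cost
  -- `R₁⁻¹ ^ n`, and `R / R₁ < 1` gives the decay.
  obtain ⟨R₂, hR₂, hR₂P⟩ := exists_between hlt
  obtain ⟨R₁, hR₁, hR₁₂⟩ := exists_between hR₂
  have hR₁0 : 0 < R₁ := R.2.trans_lt hR₁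
  have hR₂0 : 0 < R₂ := hR₁0.trans hR₁₂
  obtain ⟨N, C, hC0, hC⟩ := hR
  let V : Set (Rd d) := {η | R₂ < ‖evalI P η‖}
  have hV : IsOpen V := isOpen_lt continuous_const (continuous_evalI P).norm
  refine (Distribution.mem_dsupport_iff_not_isVanishingOn ξ).1 hξ (V ∩ Metric.ball ξ 1)
    -- The unit ball serves only to make the support of `u` compact.
    ⟨hR₂P, Metric.mem_ball_self one_pos⟩ (hV.inter Metric.isOpen_ball) fun u hu => ?_
  have huc : IsCompact (tsupport u) := (isCompact_closedBall ξ 1).of_isClosed_subset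
    isClosed_closure fun x hx => Metric.ball_subset_closedBall (hu hx).2
  obtain ⟨g, hgc, hgV, hg1, hg⟩ := exists_schwartz_cutoff huc hV fun x hx => (hu hx).1
  have hP0 : ∀ x ∈ tsupport g, evalI P x ≠ 0 := fun x hx h0 => by
    have : R₂ < ‖evalI P x‖ := hgV hx
    rw [h0, norm_zero] at this
    linarith
  have hqs := contDiff_mul_inv_of_tsupport_subset (g.smooth ⊤) (contDiff_evalI P) hP0
  have hqc : HasCompactSupport fun x => g x * (evalI P x)⁻¹ := hgc.mul_right
  let q : 𝓢(Rd d, ℂ) := hqc.toSchwartzMap hqs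
  have hq : ∀ x, q x = g x * (evalI P x)⁻¹ := fun x => rfl
  have hqR : ∀ x, ‖q x‖ ≤ R₂⁻¹ := fun x => by
    rw [hq, norm_mul, norm_inv]
    by_cases hx : g x = 0
    · simp only [hx, norm_zero, zero_mul]; positivity
    · have h1 : R₂ < ‖evalI P x‖ := hgV (subset_tsupport _ hx)
      calc _ ≤ 1 * R₂⁻¹ := mul_le_mul (hg x) (inv_anti₀ hR₂0 h1.le) (by positivity) zero_le_one
        _ = _ := one_mul _
  obtain ⟨Q, hQ, hQb⟩ := exists_seminorm_bound d N
  obtain ⟨D, l, hD0, hD⟩ := exists_continuous_seminorm_mul_pow_mul_le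
    (Q.comp ((fourierS d).toLinearMap.restrictScalars ℝ)) (hQ.comp (fourierS d).continuous) g q hqR
    (inv_strictAnti₀ hR₁0 hR₁₂)
  let B : ℝ := ∑ j ∈ Finset.range (l + 1), SchwartzMap.seminorm ℝ 0 j u
  have hB : ∀ j ≤ l, ∀ x, ‖iteratedFDeriv ℝ j u x‖ ≤ B := fun j hj x =>
    (u.norm_iteratedFDeriv_le_seminorm ℝ j x).trans
      (Finset.single_le_sum (f := fun j => SchwartzMap.seminorm ℝ 0 j u)
        (fun _ _ => apply_nonneg _ _) (Finset.mem_range.2 (by omega)))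
  have key : ∀ n : ℕ, 1 ≤ n → ‖fourierT T u‖ ≤ C * D * B * ((n : ℝ) ^ N * (R / R₁) ^ n) := by
    intro n hn
    have hs := hf.iterate_diffOp P n
    have htg : Function.HasTemperateGrowth fun x => q x ^ n := q.hasTemperateGrowth.pow n
    let v : 𝓢(Rd d, ℂ) := SchwartzMap.smulLeftCLM ℂ (fun x => q x ^ n) u
    have hv : ∀ x, v x = q x ^ n * u x := fun x => by
      rw [SchwartzMap.smulLeftCLM_apply_apply htg, smul_eq_mul]
    have hgu : ∀ x, u x ≠ 0 → g x = 1 := fun x hx => hg1.self_of_nhdsSet x (subset_tsupport _ hx)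
    have hv' : ∀ x, v x = g x * q x ^ n * u x := fun x => by
      by_cases hx : u x = 0
      · simp [hv, hx]
      · rw [hv, hgu x hx, one_mul]
    have huv : u = SchwartzMap.smulLeftCLM ℂ (fun x => evalI P x ^ n)
        (fourierSInv d (fourierS d v)) := by
      ext x
      rw [fourierSInv_fourierS, SchwartzMap.smulLeftCLM_apply_apply hs.growth, hv, smul_eq_mul]
      by_cases hx : u x = 0
      · simp [hx]
      · have h0 : evalI P x ≠ 0 := hP0 x (subset_tsupport _ (by
          rw [Function.mem_support, hgu x hx]; exact one_ne_zero))
        rw [hq, hgu x hx, one_mul, ← mul_assoc, ← mul_pow, mul_inv_cancel₀ h0, one_pow, one_mul]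
    -- `fourierS d v` need not have compact support, so the integral formula for `(diffOp P)^[n] f`
    -- does not apply to it directly; the seminorm bound, obtained by density, does.
    have h1 := hQb (fun φ => T (fourierS d (SchwartzMap.smulLeftCLM ℂ (fun x => evalI P x ^ n)
      (fourierSInv d φ)))) ((diffOp P)^[n] f) (C * (n : ℝ) ^ N * (R : ℝ) ^ n)
      (T.continuous.comp ((fourierS d).continuous.comp
        ((SchwartzMap.smulLeftCLM ℂ fun x => evalI P x ^ n).continuous.comp
          (continuous_fourierSInv d))))
      (by positivity) hs.apply_eq (hC n hn) (fourierS d v)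
    simp only [← huv] at h1
    rw [fourierT_apply]
    refine h1.trans ?_
    have h2 : Q (fourierS d v) ≤ D * R₁⁻¹ ^ n * B := hD n u v B hv' hB
    calc _ ≤ C * (n : ℝ) ^ N * (R : ℝ) ^ n * (D * R₁⁻¹ ^ n * B) :=
          mul_le_mul_of_nonneg_left h2 (by positivity)
      _ = _ := by rw [div_eq_mul_inv, mul_pow]; ring
  have hlim : Tendsto (fun n : ℕ => C * D * B * ((n : ℝ) ^ N * ((R : ℝ) / R₁) ^ n)) atTop (𝓝 0) := by
    have := tendsto_pow_const_mul_const_pow_of_abs_lt_one N (r := (R : ℝ) / R₁) (by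
      rw [abs_of_nonneg (div_nonneg R.coe_nonneg hR₁0.le), div_lt_one hR₁0]; exact hR₁)
    simpa using this.const_mul (C * D * B)
  have : ‖fourierT T u‖ ≤ 0 := ge_of_tendsto hlim (eventually_atTop.2 ⟨1, key⟩)
  exact norm_le_zero_iff.1 this

end Estimates

/-! ### From part 1 to supports: determining sets and separating polynomials -/

section Determination

variable {d : ℕ}

theorem supOn_ne_top (P : MvPolynomial (Fin d) ℂ) {S : Set (Rd d)} (hS : IsCompact S) :
    supOn P S ≠ ⊤ := by
  obtain ⟨C, hC⟩ := hS.exists_bound_of_continuousOn (continuous_evalI P).continuousOn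
  have : supOn P S ≤ ENNReal.ofReal C := iSup₂_le fun ξ hξ => by
    rw [← ofReal_norm]
    exact ENNReal.ofReal_le_ofReal (hC ξ hξ)
  exact (this.trans_lt ENNReal.ofReal_lt_top).ne

theorem supOn_mono (P : MvPolynomial (Fin d) ℂ) {S S' : Set (Rd d)} (h : S ⊆ S') :
    supOn P S ≤ supOn P S' :=
  biSup_mono h

theorem enorm_evalI_le_supOn (P : MvPolynomial (Fin d) ℂ) {S : Set (Rd d)} {ξ : Rd d}
    (hξ : ξ ∈ S) : ‖evalI P ξ‖ₑ ≤ supOn P S :=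
  le_iSup₂ (f := fun ξ _ => ‖evalI P ξ‖ₑ) ξ hξ

theorem growthExponent_eq_supportRadius {f : Rd d → ℂ} {T : 𝓢'(Rd d, ℂ)}
    (hf : HasSymbol T (fun _ => 1) f) (hsupp : IsCompact (Distribution.dsupport (fourierT T)))
    (P : MvPolynomial (Fin d) ℂ) : growthExponent P f = supportRadius P (fourierT T) := by
  refine le_antisymm ?_ (le_iInf₂ fun R hR => supportRadius_le_of_growthBound hf P R hR)
  -- Every `R` strictly above the support radius is admissible, which suffices for the infimum; the
  -- radius itself need not be.
  refine le_of_forall_gt fun c hc => ?_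
  obtain ⟨R, hR, hRc⟩ := ENNReal.lt_iff_exists_nnreal_btwn.1 hc
  exact (iInf₂_le R (growthBound_of_supportRadius_lt hf hsupp P R hR)).trans_lt hRc

/-- A real polynomial of the form `M - |· - ξ|²`. -/
theorem exists_evalI_eq_sub_norm_sq (ξ : Rd d) (M : ℝ) :
    ∃ P : MvPolynomial (Fin d) ℂ, ∀ η, evalI P η = ((M - ‖η - ξ‖ ^ 2 : ℝ) : ℂ) := by
  -- Polynomials are evaluated at `iη`, so the real coordinate `η j` is the value of `-i X_j`.
  refine ⟨MvPolynomial.C (M : ℂ) - ∑ j, (MvPolynomial.C (-Complex.I) * MvPolynomial.X j -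
    MvPolynomial.C ((ξ j : ℝ) : ℂ)) ^ 2, fun η => ?_⟩
  rw [EuclideanSpace.norm_sq_eq]
  simp only [evalI, map_sub, map_sum, map_pow, map_mul, MvPolynomial.eval_C, MvPolynomial.eval_X,
    Complex.ofReal_sub, Complex.ofReal_sum, Real.norm_eq_abs, sq_abs, PiLp.sub_apply,
    Complex.ofReal_pow]
  congr 1
  refine Finset.sum_congr rfl fun j _ => ?_
  rw [← mul_assoc, neg_mul, Complex.I_mul_I, neg_neg, one_mul]

/-- A compact subset of `ℝ^d` is determined by the set of all polynomials. -/
theorem exists_supOn_lt_enorm_evalI {K : Set (Rd d)} (hK : IsCompact K) {ξ : Rd d} (hξ : ξ ∉ K) :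
    ∃ P : MvPolynomial (Fin d) ℂ, supOn P K < ‖evalI P ξ‖ₑ := by
  obtain ⟨r, hr0, hr⟩ := Metric.isOpen_iff.1 hK.isClosed.isOpen_compl ξ hξ
  obtain ⟨C, hC⟩ := hK.exists_bound_of_continuousOn (f := fun η => η - ξ)
    (by fun_prop)
  -- On `K` one has `r ≤ ‖η - ξ‖ ≤ C`, so `M - ‖η - ξ‖²` lies between `r²` and `C²`, while at `ξ` it
  -- equals `M > C²`.
  let M : ℝ := r ^ 2 + C ^ 2
  have hM : 0 < M := add_pos_of_pos_of_nonneg (pow_pos hr0 2) (sq_nonneg C)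
  obtain ⟨P, hP⟩ := exists_evalI_eq_sub_norm_sq ξ M
  refine ⟨P, ?_⟩
  have h1 : ‖evalI P ξ‖ₑ = ENNReal.ofReal M := by
    rw [hP, sub_self, norm_zero, ← ofReal_norm, Complex.norm_real]
    congr 1
    rw [Real.norm_of_nonneg] <;> linarith
  have h2 : supOn P K ≤ ENNReal.ofReal (C ^ 2) := iSup₂_le fun η hη => by
    rw [hP, ← ofReal_norm, Complex.norm_real]
    refine ENNReal.ofReal_le_ofReal (abs_le.2 ?_)
    have h3 : r ≤ ‖η - ξ‖ := by
      by_contra! h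
      exact hr (by rwa [Metric.mem_ball, dist_eq_norm]) hη
    have h4 := pow_le_pow_left₀ hr0.le h3 2
    have h5 := pow_le_pow_left₀ (norm_nonneg _) (hC η hη) 2
    constructor <;> simp only [M] <;> nlinarith
  rw [h1]
  exact h2.trans_lt ((ENNReal.ofReal_lt_ofReal_iff hM).2
    (by simp only [M]; nlinarith [pow_pos hr0 2]))

end Determination

end RealPaleyWiener

end

/-! ### The main theorem -/

theorem mainTheorem8 (d : ℕ) (f : RealPaleyWiener.Rd d → ℂ) (hf : ContDiff ℝ ∞ f)
    (T : 𝓢'(RealPaleyWiener.Rd d, ℂ)) (hT : RealPaleyWiener.Represents f T)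
    (hsupp : IsCompact (Distribution.dsupport (RealPaleyWiener.fourierT T))) :
    (∀ P : MvPolynomial (Fin d) ℂ,
      RealPaleyWiener.growthExponent P f ≠ ⊤ ∧
      RealPaleyWiener.growthExponent P f =
        RealPaleyWiener.supportRadius P (RealPaleyWiener.fourierT T)) ∧
    (∀ K : Set (RealPaleyWiener.Rd d), K.Nonempty → IsCompact K →
      ∀ 𝒬 : Set (MvPolynomial (Fin d) ℂ), RealPaleyWiener.Determines 𝒬 K →
        (Distribution.dsupport (RealPaleyWiener.fourierT T) ⊆ K ↔
          ∀ P ∈ 𝒬, RealPaleyWiener.growthExponent P f ≤ RealPaleyWiener.supOn P K)) ∧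
    (∀ 𝒬 : Set (MvPolynomial (Fin d) ℂ),
      RealPaleyWiener.Determines 𝒬 (Distribution.dsupport (RealPaleyWiener.fourierT T)) →
        ∀ ξ : RealPaleyWiener.Rd d,
          ξ ∈ Distribution.dsupport (RealPaleyWiener.fourierT T) ↔
            ∀ P ∈ 𝒬, ‖RealPaleyWiener.evalI P ξ‖ₑ ≤ RealPaleyWiener.growthExponent P f) ∧
    Distribution.dsupport (RealPaleyWiener.fourierT T) =
      {ξ : RealPaleyWiener.Rd d | ∀ P : MvPolynomial (Fin d) ℂ,
        ‖RealPaleyWiener.evalI P ξ‖ₑ ≤ RealPaleyWiener.growthExponent P f} := by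
  have hS := RealPaleyWiener.HasSymbol.of_represents hf hT
  have h1 := RealPaleyWiener.growthExponent_eq_supportRadius hS hsupp
  have hmem : ∀ 𝒬 : Set (MvPolynomial (Fin d) ℂ), ∀ K : Set (RealPaleyWiener.Rd d),
      RealPaleyWiener.Determines 𝒬 K → ∀ ξ : RealPaleyWiener.Rd d, ξ ∈ K ↔
        ∀ P ∈ 𝒬, ‖RealPaleyWiener.evalI P ξ‖ₑ ≤ RealPaleyWiener.supOn P K := by
    intro 𝒬 K hK ξ
    constructor
    · exact fun hξ P _ => RealPaleyWiener.enorm_evalI_le_supOn P hξ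
    · intro h
      rw [hK]
      exact Set.mem_iInter₂.2 h
  refine ⟨fun P => ⟨?_, h1 P⟩, fun K _ hK 𝒬 h𝒬 => ⟨fun hsub P _ => ?_, fun h ξ hξ => ?_⟩,
    fun 𝒬 h𝒬 ξ => ?_, ?_⟩
  · rw [h1 P]
    exact RealPaleyWiener.supOn_ne_top P hsupp
  · rw [h1 P]
    exact RealPaleyWiener.supOn_mono P hsub
  · refine (hmem 𝒬 K h𝒬 ξ).2 fun P hP => ?_
    refine (RealPaleyWiener.enorm_evalI_le_supOn P hξ).trans ?_
    exact (h1 P).symm.le.trans (h P hP)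
  · simp only [h1]
    exact hmem 𝒬 _ h𝒬 ξ
  · ext ξ
    simp only [h1]
    refine ⟨fun hξ P => RealPaleyWiener.enorm_evalI_le_supOn P hξ, fun h => ?_⟩
    by_contra hξ
    obtain ⟨P, hP⟩ := RealPaleyWiener.exists_supOn_lt_enorm_evalI hsupp hξ
    exact absurd (h P) (not_le.2 hP)
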